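/- All Hilbert spaces are finite-dimensional and complex, each with a fixed computational (orthonormal) basis; states are unit vectors, and all subspaces considered below are nonzero. For a bipartite state $\psi$ with Schmidt decomposition $\psi=\sum_i\sqrt{\lambda_i}\,e_i\otimes f_i$ let $G(\psi)=1-\max_i\lambda_i$. For a multipartite state $\psi$ let $G_{GME}(\psi)=\min_{A|\bar A}G_{A|\bar A}(\psi)$, where $A|\bar A$ runs over all partitions of the set of parties into two nonempty parts and $G_{A|\bar A}(\psi)$ is $G$ of $\psi$ regarded as a bipartite state with respect to $A|\bar A$. For a subspace $\mathcal S$ let $G(\mathcal S)$, respectively $G_{GME}(\mathcal S)$, be the minimum of $G(\psi)$, respectively $G_{GME}(\psi)$, over the states $\psi\in\mathcal S$. A subspace of a bipartite space is completely entangled if none of its states is a product $\phi\otimes\chi$; a subspace of a multipartite space is genuinely entangled if none of its states is a product $\phi_A\otimes\chi_{\bar A}$ with respect to any bipartite cut $A|\bar A$. Let $n\ge 2$, and for $1\le i\le n$ let $\mathcal S^{(i)}\subset\mathcal H_{A_{2i-1}}\otimes\mathcal H_{A_{2i}}$ be a (nonzero) completely entangled subspace. Let $\mathcal W=\mathcal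 S^{(1)}\otimes\cdots\otimes\mathcal S^{(n)}$, regarded as a subspace of the $(n+1)$-partite space $\mathcal H_{A_1}\otimes\mathcal H_{A_2'}\otimes\cdots\otimes\mathcal H_{A_n'}\otimes\mathcal H_{A_{2n}}$ obtained by joining, for $2\le k\le n$, the adjacent subsystems $A_{2k-2}$ and $A_{2k-1}$ into one party $A_k'=A_{2k-2}A_{2k-1}$. Then $\mathcal W$ is genuinely entangled, all the minima $G(\mathcal S^{(i)})$ and $G_{GME}(\mathcal W)$ are attained, and $$G_{GME}(\mathcal W)=\min\bigl(G(\mathcal S^{(1)}),\ldots,G(\mathcal S^{(n)})\bigr).$$ -/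

import Mathlib

noncomputable section

namespace EntangledSubspace

/-! Every finite-dimensional Hilbert space comes with its fixed computational (orthonormal) basis:
a system whose basis is labelled by the finite type `a` has the Hilbert space `EuclideanSpace ℂ a`,
and a composite system has the Hilbert space whose basis is labelled by tuples of labels. -/

section Bipartite

variable {a b : Type*} [Fintype a] [Fintype b]

/-- The tensor product `φ ⊗ χ` of two vectors, as a vector of the bipartite space with
product basis `a × b`. -/
def tmul (φ : EuclideanSpace ℂ a) (χ : EuclideanSpace ℂ b) : EuclideanSpace ℂ (a × b) :=
  WithLp.toLp 2 fun x => φ x.1 * χ x.2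

/-- `ψ` is a product vector; a state that is not a product vector is entangled. -/
def IsProduct (ψ : EuclideanSpace ℂ (a × b)) : Prop :=
  ∃ (φ : EuclideanSpace ℂ a) (χ : EuclideanSpace ℂ b), ψ = tmul φ χ

/-- A Schmidt decomposition `ψ = ∑ i, √(lam i) • e i ⊗ f i`; the numbers `lam i` are the squared
Schmidt coefficients. -/
def IsSchmidtDecomposition (ψ : EuclideanSpace ℂ (a × b)) {r : ℕ} (lam : Fin r → ℝ)
    (e : Fin r → EuclideanSpace ℂ a) (f : Fin r → EuclideanSpace ℂ b) : Prop :=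
  Orthonormal ℂ e ∧ Orthonormal ℂ f ∧ (∀ i, 0 ≤ lam i) ∧
    ψ = ∑ i, ((√(lam i) : ℝ) : ℂ) • tmul (e i) (f i)

/-- The set of squared Schmidt coefficients of `ψ`. -/
def schmidtSq (ψ : EuclideanSpace ℂ (a × b)) : Set ℝ :=
  {c | ∃ (r : ℕ) (lam : Fin r → ℝ) (e : Fin r → EuclideanSpace ℂ a)
    (f : Fin r → EuclideanSpace ℂ b), IsSchmidtDecomposition ψ lam e f ∧ ∃ i, lam i = c}

/-- The geometric measure of entanglement `G(ψ) = 1 - max_i λ_i` of a bipartite pure state. -/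
def geometricMeasure (ψ : EuclideanSpace ℂ (a × b)) : ℝ :=
  1 - sSup (schmidtSq ψ)

end Bipartite

section Subspaces

variable {c : Type*} [Fintype c]

/-- The (pure) states in a subspace: its unit vectors. -/
def states (S : Submodule ℂ (EuclideanSpace ℂ c)) : Set (EuclideanSpace ℂ c) :=
  {ψ | ψ ∈ S ∧ ‖ψ‖ = 1}

/-- The entanglement `EM(S) = min_{ψ ∈ S} EM(ψ)` of a subspace, for an entanglement measure `EM`
of pure states. -/
def subspaceMeasure (EM : EuclideanSpace ℂ c → ℝ) (S : Submodule ℂ (EuclideanSpace ℂ c)) : ℝ :=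
  sInf (EM '' states S)

/-- A completely entangled subspace of a bipartite space: all its states are entangled. -/
def IsCompletelyEntangled {a b : Type*} [Fintype a] [Fintype b]
    (S : Submodule ℂ (EuclideanSpace ℂ (a × b))) : Prop :=
  ∀ ψ ∈ states S, ¬ IsProduct ψ

end Subspaces

section Multipartite

variable {P : Type*} [Fintype P] [DecidableEq P] {κ : P → Type*} [∀ p, Fintype (κ p)]

/-- A bipartite cut `A | Aᶜ` of the set `P` of parties; both sides are nonempty. -/
abbrev Cut (P : Type*) [Fintype P] [DecidableEq P] : Type _ :=
  {A : Finset P // A.Nonempty ∧ Aᶜ.Nonempty}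

/-- A multipartite vector regarded as a bipartite one with respect to the cut `A | Aᶜ`. -/
def acrossCut (A : Finset P) :
    EuclideanSpace ℂ (∀ p, κ p) ≃ₗᵢ[ℂ]
      EuclideanSpace ℂ ((∀ p : {p // p ∈ A}, κ p) × (∀ p : {p // p ∉ A}, κ p)) :=
  LinearIsometryEquiv.piLpCongrLeft 2 ℂ ℂ (Equiv.piEquivPiSubtypeProd (fun p => p ∈ A) κ)

/-- A multipartite pure state is biseparable if it is a product with respect to some cut. -/
def IsBiseparable (ψ : EuclideanSpace ℂ (∀ p, κ p)) : Prop :=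
  ∃ A : Cut P, IsProduct (acrossCut A.1 ψ)

/-- A genuinely entangled subspace: none of its states is biseparable. -/
def IsGenuinelyEntangled (W : Submodule ℂ (EuclideanSpace ℂ (∀ p, κ p))) : Prop :=
  ∀ ψ ∈ states W, ¬ IsBiseparable ψ

/-- The geometric measure of genuine multipartite entanglement: the minimum over all bipartite
cuts of the geometric measure across the cut. -/
def geometricMeasureGME (ψ : EuclideanSpace ℂ (∀ p, κ p)) : ℝ :=
  ⨅ A : Cut P, geometricMeasure (acrossCut A.1 ψ)

end Multipartite

section Joining

variable {n : ℕ} {α β : Fin n → Type*}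

/-- The tensor product of the vectors `ψ i`, where `ψ i` is a vector of the bipartite space
with product basis `α i × β i`. -/
def tprod [∀ i, Fintype (α i)] [∀ i, Fintype (β i)]
    (ψ : ∀ i, EuclideanSpace ℂ (α i × β i)) : EuclideanSpace ℂ (∀ i, α i × β i) :=
  WithLp.toLp 2 fun x => ∏ i, ψ i (x i)

/-- The tensor product of the subspaces `S i`: the span of the products of their vectors. -/
def tensorSubspace [∀ i, Fintype (α i)] [∀ i, Fintype (β i)]
    (S : ∀ i, Submodule ℂ (EuclideanSpace ℂ (α i × β i))) :
    Submodule ℂ (EuclideanSpace ℂ (∀ i, α i × β i)) :=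
  Submodule.span ℂ {v | ∃ ψ : ∀ i, EuclideanSpace ℂ (α i × β i), (∀ i, ψ i ∈ S i) ∧ v = tprod ψ}

/-- The basis labels of the `k`-th party (`k = 0, …, n`) after the joining: the party consists of
the second subsystem of the pair `k - 1` (if `k ≥ 1`) and the first subsystem of the pair `k`
(if `k < n`). Each of the two factors is a product over at most one index. -/
abbrev Party (α β : Fin n → Type*) (k : Fin (n + 1)) : Type _ :=
  (∀ i : {i : Fin n // i.succ = k}, β i) × (∀ i : {i : Fin n // i.castSucc = k}, α i)

/-- The relabelling of the product basis by which adjacent subsystems are joined. -/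
def joinEquiv (α β : Fin n → Type*) : (∀ i, α i × β i) ≃ (∀ k, Party α β k) where
  toFun x _ := (fun i => (x i).2, fun i => (x i).1)
  invFun y i := ((y i.castSucc).2 ⟨i, rfl⟩, (y i.succ).1 ⟨i, rfl⟩)
  left_inv _ := rfl
  right_inv y := by
    funext k
    refine Prod.ext (funext ?_) (funext ?_)
    · rintro ⟨i, rfl⟩
      rfl
    · rintro ⟨i, rfl⟩
      rfl

/-- The subspace `S 0 ⊗ ⋯ ⊗ S (n - 1)` of the `(n + 1)`-partite space that arises by joining the
second subsystem of each pair with the first subsystem of the next pair. -/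
def joinedSubspace [∀ i, Fintype (α i)] [∀ i, Fintype (β i)]
    (S : ∀ i, Submodule ℂ (EuclideanSpace ℂ (α i × β i))) :
    Submodule ℂ (EuclideanSpace ℂ (∀ k, Party α β k)) :=
  (tensorSubspace S).map
    (LinearIsometryEquiv.piLpCongrLeft 2 ℂ ℂ (joinEquiv α β)).toLinearEquiv.toLinearMap

end Joining

end EntangledSubspace

end

/-! The largest squared Schmidt coefficient of `ψ` is the best constant `c` in `|⟨φ ⊗ χ, ψ⟩|² ≤ c
‖φ‖² ‖χ‖²` (`sSup_schmidtSq_le`, `norm_inner_tmul_sq_le`), so bounds on `G` are bounds on overlaps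
with product vectors.

Lower bound: the joined parties form a chain, so every cut separates the two halves of some pair `i`
(`exists_separated_pair`). Fixing the labels of all other pairs turns a product across the cut into
a product on pair `i` (`isProduct_slice`), and a vector of the tensor product of the `S j` into a
vector of `S i` (`slice_mem`). Each slice overlap obeys the bound of `S i`, and Cauchy–Schwarz over
the slices gives it for the whole vector. A nonzero slice of a biseparable state would likewise be a
product in `S i`, whence genuine entanglement.

Upper bound: in a product of minimisers, the cut after party `i` splits pair `i` alone, so its
measure is at most that of the `i`-th factor. -/

noncomputable section

set_option linter.unusedSectionVars false

namespace EntangledSubspace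

/-! ### Schmidt decomposition and overlaps with product vectors -/

section Bipartite

variable {a b : Type*} [Fintype a] [Fintype b]

@[simp]
theorem tmul_apply (φ : EuclideanSpace ℂ a) (χ : EuclideanSpace ℂ b) (x : a × b) :
    tmul φ χ x = φ x.1 * χ x.2 := rfl

theorem inner_tmul_tmul (φ φ' : EuclideanSpace ℂ a) (χ χ' : EuclideanSpace ℂ b) :
    inner ℂ (tmul φ χ) (tmul φ' χ') = inner ℂ φ φ' * inner ℂ χ χ' := by
  simp only [PiLp.inner_apply, tmul_apply, RCLike.inner_apply, map_mul]
  rw [Fintype.sum_mul_sum, Fintype.sum_prod_type]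
  exact Finset.sum_congr rfl fun i _ => Finset.sum_congr rfl fun j _ => by ring

theorem norm_tmul (φ : EuclideanSpace ℂ a) (χ : EuclideanSpace ℂ b) :
    ‖tmul φ χ‖ = ‖φ‖ * ‖χ‖ := by
  have h := inner_tmul_tmul φ φ χ χ
  simp only [inner_self_eq_norm_sq_to_K] at h
  have h2 : ‖tmul φ χ‖ ^ 2 = (‖φ‖ * ‖χ‖) ^ 2 := by
    rw [mul_pow]
    exact_mod_cast h
  exact (sq_eq_sq₀ (norm_nonneg _) (by positivity)).1 h2

theorem tmul_smul_left (c : ℂ) (φ : EuclideanSpace ℂ a) (χ : EuclideanSpace ℂ b) :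
    tmul (c • φ) χ = c • tmul φ χ := by
  ext x
  simp [mul_assoc]

/-- The linear map whose matrix in the computational bases is the coefficient matrix of `ψ`. -/
def coeffMap (ψ : EuclideanSpace ℂ (a × b)) : EuclideanSpace ℂ b →ₗ[ℂ] EuclideanSpace ℂ a where
  toFun v := WithLp.toLp 2 fun x => ∑ y, ψ (x, y) * v y
  map_add' v w := by
    ext x
    simp [mul_add, Finset.sum_add_distrib]
  map_smul' c v := by
    ext x
    simp only [PiLp.smul_apply, smul_eq_mul, Finset.mul_sum, RingHom.id_apply]
    exact Finset.sum_congr rfl fun y _ => by ring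

theorem coeffMap_apply (ψ : EuclideanSpace ℂ (a × b)) (v : EuclideanSpace ℂ b) (x : a) :
    coeffMap ψ v x = ∑ y, ψ (x, y) * v y := rfl

/-- Componentwise complex conjugation. -/
def conjVec (v : EuclideanSpace ℂ b) : EuclideanSpace ℂ b :=
  WithLp.toLp 2 fun y => starRingEnd ℂ (v y)

theorem inner_conjVec (v w : EuclideanSpace ℂ b) :
    inner ℂ (conjVec v) (conjVec w) = inner ℂ w v := by
  simp [PiLp.inner_apply, conjVec, mul_comm]

theorem orthonormal_conjVec {ι : Type*} {v : ι → EuclideanSpace ℂ b} (hv : Orthonormal ℂ v) :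
    Orthonormal ℂ fun i => conjVec (v i) := by
  classical
  rw [orthonormal_iff_ite] at hv ⊢
  intro i j
  rw [inner_conjVec, hv]
  simp [eq_comm]

theorem eq_sum_tmul_coeffMap {ι : Type*} [Fintype ι] (ψ : EuclideanSpace ℂ (a × b))
    (v : OrthonormalBasis ι ℂ (EuclideanSpace ℂ b)) :
    ψ = ∑ j, tmul (coeffMap ψ (v j)) (conjVec (v j)) := by
  classical
  ext ⟨x, y⟩
  have h1 : coeffMap ψ (EuclideanSpace.single y (1 : ℂ)) x = ψ (x, y) := by
    simp [coeffMap_apply]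
  have h2 := v.sum_repr' (EuclideanSpace.single y (1 : ℂ))
  rw [← h1]
  conv_lhs => rw [← h2]
  simp [conjVec, mul_comm, EuclideanSpace.inner_single_right]

/-- An eigenbasis of `T†T` works, since `⟨T vᵢ, T vⱼ⟩ = ⟨vᵢ, T†T vⱼ⟩`. -/
theorem exists_orthonormalBasis_orthogonal_images {E F : Type*} [NormedAddCommGroup E]
    [InnerProductSpace ℂ E] [FiniteDimensional ℂ E] [NormedAddCommGroup F]
    [InnerProductSpace ℂ F] [FiniteDimensional ℂ F] (T : E →ₗ[ℂ] F) :
    ∃ v : OrthonormalBasis (Fin (Module.finrank ℂ E)) ℂ E,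
      ∀ i j, i ≠ j → inner ℂ (T (v i)) (T (v j)) = 0 := by
  have hT := T.isPositive_adjoint_comp_self.isSymmetric
  refine ⟨hT.eigenvectorBasis rfl, fun i j hij => ?_⟩
  rw [← LinearMap.adjoint_inner_right]
  have := hT.apply_eigenvectorBasis rfl j
  rw [LinearMap.comp_apply] at this
  rw [this, inner_smul_right, (hT.eigenvectorBasis rfl).orthonormal.2 hij, mul_zero]

/-- Singular value decomposition of the coefficient matrix: discard the basis vectors with zero
image and normalise the remaining images. -/
theorem exists_isSchmidtDecomposition (ψ : EuclideanSpace ℂ (a × b)) :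
    ∃ (r : ℕ) (lam : Fin r → ℝ) (e : Fin r → EuclideanSpace ℂ a)
      (f : Fin r → EuclideanSpace ℂ b), IsSchmidtDecomposition ψ lam e f := by
  classical
  obtain ⟨v, hv⟩ := exists_orthonormalBasis_orthogonal_images (coeffMap ψ)
  set T := coeffMap ψ with hTdef
  let J := {j // T (v j) ≠ 0}
  let σ := Fintype.equivFin J
  have hnz (j : J) : (‖T (v j)‖ : ℂ) ≠ 0 := by simpa using j.2
  have hon : Orthonormal ℂ fun j : J => (‖T (v j)‖ : ℂ)⁻¹ • T (v j) := by
    refine ⟨fun j => ?_, fun i j hij => ?_⟩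
    · simpa using norm_smul_inv_norm (𝕜 := ℂ) j.2
    · beta_reduce
      rw [inner_smul_left, inner_smul_right, hv _ _ fun h => hij (Subtype.ext h)]
      simp
  refine ⟨Fintype.card J, fun i => ‖T (v (σ.symm i))‖ ^ 2, _, _,
    hon.comp σ.symm σ.symm.injective,
    (orthonormal_conjVec v.orthonormal).comp (fun i => (σ.symm i : J).1)
      (Subtype.val_injective.comp σ.symm.injective), fun i => sq_nonneg _, ?_⟩
  have hterm (j : J) : ((√(‖T (v j)‖ ^ 2) : ℝ) : ℂ) •
      tmul ((‖T (v j)‖ : ℂ)⁻¹ • T (v j)) (conjVec (v j)) = tmul (T (v j)) (conjVec (v j)) := by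
    rw [Real.sqrt_sq (norm_nonneg _), ← tmul_smul_left, smul_smul, mul_inv_cancel₀ (hnz j),
      one_smul]
  simp only [Function.comp_apply, hterm]
  rw [σ.symm.sum_comp (fun j : J => tmul (T (v j)) (conjVec (v j)))]
  conv_lhs => rw [eq_sum_tmul_coeffMap ψ v, ← hTdef]
  rw [← Finset.sum_subtype (Finset.univ.filter fun j => T (v j) ≠ 0) (by simp)
    fun j => tmul (T (v j)) (conjVec (v j))]
  refine (Finset.sum_filter_of_ne (p := fun j => T (v j) ≠ 0) fun j _ hj h0 => hj ?_).symm
  rw [h0]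
  ext x
  simp

theorem IsSchmidtDecomposition.inner_tmul {ψ : EuclideanSpace ℂ (a × b)} {r : ℕ}
    {lam : Fin r → ℝ} {e : Fin r → EuclideanSpace ℂ a} {f : Fin r → EuclideanSpace ℂ b}
    (h : IsSchmidtDecomposition ψ lam e f) (i : Fin r) :
    inner ℂ (tmul (e i) (f i)) ψ = ((√(lam i) : ℝ) : ℂ) := by
  obtain ⟨he, hf, -, rfl⟩ := h
  rw [orthonormal_iff_ite] at he hf
  simp [inner_tmul_tmul, he, hf]

theorem schmidtSq_le {ψ : EuclideanSpace ℂ (a × b)} {c : ℝ}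
    (hc : ∀ φ χ, ‖inner ℂ (tmul φ χ) ψ‖ ^ 2 ≤ c * (‖φ‖ ^ 2 * ‖χ‖ ^ 2)) {l : ℝ}
    (hl : l ∈ schmidtSq ψ) : l ≤ c := by
  obtain ⟨r, lam, e, f, h, i, rfl⟩ := hl
  have := hc (e i) (f i)
  rw [h.inner_tmul, h.1.1 i, h.2.1.1 i] at this
  simpa [Real.sq_sqrt (h.2.2.1 i)] using this

theorem bddAbove_schmidtSq (ψ : EuclideanSpace ℂ (a × b)) : BddAbove (schmidtSq ψ) := by
  refine ⟨‖ψ‖ ^ 2, fun l hl => schmidtSq_le (fun φ χ => ?_) hl⟩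
  have := norm_inner_le_norm (𝕜 := ℂ) (tmul φ χ) ψ
  rw [norm_tmul] at this
  calc _ ≤ (‖φ‖ * ‖χ‖ * ‖ψ‖) ^ 2 := by gcongr
    _ = _ := by ring

theorem sSup_schmidtSq_nonneg (ψ : EuclideanSpace ℂ (a × b)) : 0 ≤ sSup (schmidtSq ψ) := by
  refine Real.sSup_nonneg ?_
  rintro l ⟨r, lam, e, f, h, i, rfl⟩
  exact h.2.2.1 i

/-- `hc0` covers an empty set of coefficients, whose real `sSup` is `0`. -/
theorem sSup_schmidtSq_le {ψ : EuclideanSpace ℂ (a × b)} {c : ℝ} (hc0 : 0 ≤ c)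
    (hc : ∀ φ χ, ‖inner ℂ (tmul φ χ) ψ‖ ^ 2 ≤ c * (‖φ‖ ^ 2 * ‖χ‖ ^ 2)) :
    sSup (schmidtSq ψ) ≤ c :=
  Real.sSup_le (fun _ hl => schmidtSq_le hc hl) hc0

/-- Expand `ψ` in one Schmidt decomposition, then apply Cauchy–Schwarz and Bessel's inequality to
both orthonormal families. -/
theorem norm_inner_tmul_sq_le (ψ : EuclideanSpace ℂ (a × b)) (φ : EuclideanSpace ℂ a)
    (χ : EuclideanSpace ℂ b) :
    ‖inner ℂ (tmul φ χ) ψ‖ ^ 2 ≤ sSup (schmidtSq ψ) * (‖φ‖ ^ 2 * ‖χ‖ ^ 2) := by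
  obtain ⟨r, lam, e, f, h⟩ := exists_isSchmidtDecomposition ψ
  set M := sSup (schmidtSq ψ)
  have hM (i : Fin r) : lam i ≤ M :=
    le_csSup (bddAbove_schmidtSq ψ) ⟨r, lam, e, f, h, i, rfl⟩
  obtain ⟨he, hf, -, hψ⟩ := h
  have h1 : ‖inner ℂ (tmul φ χ) ψ‖ ≤ ∑ i, √M * (‖inner ℂ (e i) φ‖ * ‖inner ℂ (f i) χ‖) := by
    rw [hψ, inner_sum]
    refine (norm_sum_le _ _).trans (Finset.sum_le_sum fun i _ => ?_)
    rw [inner_smul_right, inner_tmul_tmul, norm_mul, norm_mul, norm_inner_symm φ,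
      norm_inner_symm χ, Complex.norm_real, Real.norm_of_nonneg (Real.sqrt_nonneg _)]
    gcongr
    exact hM i
  have h2 := Finset.sum_mul_sq_le_sq_mul_sq Finset.univ (fun i => ‖inner ℂ (e i) φ‖)
    (fun i => ‖inner ℂ (f i) χ‖)
  rw [← Finset.mul_sum] at h1
  calc _ ≤ (√M * ∑ i, ‖inner ℂ (e i) φ‖ * ‖inner ℂ (f i) χ‖) ^ 2 := by gcongr
    _ = M * (∑ i, ‖inner ℂ (e i) φ‖ * ‖inner ℂ (f i) χ‖) ^ 2 := by
      rw [mul_pow, Real.sq_sqrt (sSup_schmidtSq_nonneg ψ)]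
    _ ≤ M * ((∑ i, ‖inner ℂ (e i) φ‖ ^ 2) * ∑ i, ‖inner ℂ (f i) χ‖ ^ 2) := by
      gcongr
      exact sSup_schmidtSq_nonneg ψ
    _ ≤ _ := by
      gcongr
      · exact sSup_schmidtSq_nonneg ψ
      · exact he.sum_inner_products_le φ
      · exact hf.sum_inner_products_le χ

/-- The square root is the best bound on `|⟨φ ⊗ χ, ψ⟩|`, which is subadditive in `ψ`; hence it is
1-Lipschitz, and `G` is continuous. -/
theorem sqrt_sSup_schmidtSq_le (ψ ψ' : EuclideanSpace ℂ (a × b)) :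
    √(sSup (schmidtSq ψ)) ≤ √(sSup (schmidtSq ψ')) + dist ψ ψ' := by
  rw [Real.sqrt_le_left (by positivity)]
  refine sSup_schmidtSq_le (by positivity) fun φ χ => ?_
  have h1 : ‖inner ℂ (tmul φ χ) ψ'‖ ≤ √(sSup (schmidtSq ψ')) * (‖φ‖ * ‖χ‖) := by
    refine (abs_le_of_sq_le_sq' ?_ (by positivity)).2
    rw [mul_pow, Real.sq_sqrt (sSup_schmidtSq_nonneg ψ'), mul_pow]
    exact norm_inner_tmul_sq_le ψ' φ χ
  have h2 : ‖inner ℂ (tmul φ χ) (ψ - ψ')‖ ≤ ‖φ‖ * ‖χ‖ * dist ψ ψ' := by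
    rw [dist_eq_norm, ← norm_tmul]
    exact norm_inner_le_norm _ _
  have h3 : ‖inner ℂ (tmul φ χ) ψ‖ ≤
      (√(sSup (schmidtSq ψ')) + dist ψ ψ') * (‖φ‖ * ‖χ‖) := by
    have h4 : inner ℂ (tmul φ χ) ψ = inner ℂ (tmul φ χ) ψ' + inner ℂ (tmul φ χ) (ψ - ψ') := by
      rw [inner_sub_right]
      ring
    rw [h4]
    refine (norm_add_le _ _).trans ?_
    linarith
  calc _ ≤ ((√(sSup (schmidtSq ψ')) + dist ψ ψ') * (‖φ‖ * ‖χ‖)) ^ 2 := by gcongr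
    _ = _ := by ring

theorem continuous_geometricMeasure :
    Continuous (geometricMeasure : EuclideanSpace ℂ (a × b) → ℝ) := by
  have h : LipschitzWith 1 fun ψ : EuclideanSpace ℂ (a × b) => √(sSup (schmidtSq ψ)) :=
    LipschitzWith.of_le_add sqrt_sSup_schmidtSq_le
  have h2 : (geometricMeasure : EuclideanSpace ℂ (a × b) → ℝ) =
      fun ψ => 1 - √(sSup (schmidtSq ψ)) ^ 2 := by
    funext ψ
    rw [Real.sq_sqrt (sSup_schmidtSq_nonneg ψ), geometricMeasure]
  rw [h2]
  exact continuous_const.sub (h.continuous.pow 2)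

end Bipartite

/-! ### Attainment of the minimum over a subspace -/

section Subspaces

variable {c : Type*} [Fintype c]

theorem smul_mem_states {S : Submodule ℂ (EuclideanSpace ℂ c)} {v : EuclideanSpace ℂ c}
    (hv : v ∈ S) (h0 : v ≠ 0) : (‖v‖ : ℂ)⁻¹ • v ∈ states S :=
  ⟨S.smul_mem _ hv, by simpa using norm_smul_inv_norm (𝕜 := ℂ) h0⟩

theorem states_nonempty {S : Submodule ℂ (EuclideanSpace ℂ c)} (hS : S ≠ ⊥) :
    (states S).Nonempty := by
  obtain ⟨v, hv, h0⟩ := S.ne_bot_iff.1 hS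
  exact ⟨_, smul_mem_states hv h0⟩

theorem isCompact_states (S : Submodule ℂ (EuclideanSpace ℂ c)) : IsCompact (states S) := by
  have h : states S = Metric.sphere 0 1 ∩ (S : Set (EuclideanSpace ℂ c)) := by
    ext v
    simp [states, and_comm]
  rw [h]
  exact (isCompact_sphere 0 1).inter_right S.closed_of_finiteDimensional

theorem isLeast_subspaceMeasure {EM : EuclideanSpace ℂ c → ℝ} (hEM : Continuous EM)
    {S : Submodule ℂ (EuclideanSpace ℂ c)} (hS : S ≠ ⊥) :
    IsLeast (EM '' states S) (subspaceMeasure EM S) :=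
  ((isCompact_states S).image hEM).isLeast_sInf ((states_nonempty hS).image EM)

/-- The homogeneous form is needed because slices are not normalised. -/
theorem norm_inner_tmul_sq_le_of_mem {a b : Type*} [Fintype a] [Fintype b]
    {S : Submodule ℂ (EuclideanSpace ℂ (a × b))} (hS : S ≠ ⊥) {s : EuclideanSpace ℂ (a × b)}
    (hs : s ∈ S) (φ : EuclideanSpace ℂ a) (χ : EuclideanSpace ℂ b) :
    ‖inner ℂ (tmul φ χ) s‖ ^ 2 ≤
      (1 - subspaceMeasure geometricMeasure S) * (‖tmul φ χ‖ ^ 2 * ‖s‖ ^ 2) := by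
  rcases eq_or_ne s 0 with rfl | h0
  · simp
  have h1 := (isLeast_subspaceMeasure continuous_geometricMeasure hS).2
    ⟨_, smul_mem_states hs h0, rfl⟩
  have h2 := norm_inner_tmul_sq_le ((‖s‖ : ℂ)⁻¹ • s) φ χ
  have hn : 0 < ‖s‖ := norm_pos_iff.2 h0
  rw [inner_smul_right, norm_mul, norm_inv, Complex.norm_real, norm_norm, mul_pow, inv_pow,
    inv_mul_le_iff₀ (by positivity)] at h2
  rw [geometricMeasure] at h1
  rw [norm_tmul, mul_pow]
  refine h2.trans ?_
  rw [mul_comm, mul_assoc]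
  gcongr
  linarith

end Subspaces

/-! ### Slices along one tensor factor -/

section Slices

variable {ι : Type*} [Fintype ι] [DecidableEq ι] {γ : ι → Type*} [∀ j, Fintype (γ j)]

/-- The vector of the `i`-th tensor factor that is obtained from `θ` by fixing the basis labels of
all the other factors. -/
def slice (i : ι) (r : ∀ j : {j // j ≠ i}, γ j) :
    EuclideanSpace ℂ (∀ j, γ j) →ₗ[ℂ] EuclideanSpace ℂ (γ i) where
  toFun θ := WithLp.toLp 2 fun p => θ ((Equiv.piSplitAt i γ).symm (p, r))
  map_add' _ _ := rfl
  map_smul' _ _ := rfl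

theorem slice_apply (i : ι) (r : ∀ j : {j // j ≠ i}, γ j) (θ : EuclideanSpace ℂ (∀ j, γ j))
    (p : γ i) : slice i r θ p = θ ((Equiv.piSplitAt i γ).symm (p, r)) := rfl

theorem sum_inner_slice (i : ι) (θ ψ : EuclideanSpace ℂ (∀ j, γ j)) :
    ∑ r, inner ℂ (slice i r θ) (slice i r ψ) = inner ℂ θ ψ := by
  simp only [PiLp.inner_apply, slice_apply]
  rw [← (Equiv.piSplitAt i γ).symm.sum_comp, Fintype.sum_prod_type_right]

theorem sum_norm_slice_sq (i : ι) (θ : EuclideanSpace ℂ (∀ j, γ j)) :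
    ∑ r, ‖slice i r θ‖ ^ 2 = ‖θ‖ ^ 2 := by
  have h := sum_inner_slice i θ θ
  simp only [inner_self_eq_norm_sq_to_K] at h
  exact_mod_cast h

theorem exists_slice_ne_zero (i : ι) {θ : EuclideanSpace ℂ (∀ j, γ j)} (h : θ ≠ 0) :
    ∃ r, slice i r θ ≠ 0 := by
  by_contra! h0
  have h1 := sum_norm_slice_sq i θ
  simp only [h0, norm_zero, ne_eq, OfNat.ofNat_ne_zero, not_false_eq_true, zero_pow,
    Finset.sum_const_zero] at h1
  exact h (norm_eq_zero.1 (pow_eq_zero_iff two_ne_zero |>.1 h1.symm))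

theorem norm_inner_sq_le_of_slice (i : ι) {θ ψ : EuclideanSpace ℂ (∀ j, γ j)} {c : ℝ}
    (hc0 : 0 ≤ c)
    (hc : ∀ r, ‖inner ℂ (slice i r θ) (slice i r ψ)‖ ^ 2 ≤
      c * (‖slice i r θ‖ ^ 2 * ‖slice i r ψ‖ ^ 2)) :
    ‖inner ℂ θ ψ‖ ^ 2 ≤ c * (‖θ‖ ^ 2 * ‖ψ‖ ^ 2) := by
  have h1 (r) : ‖inner ℂ (slice i r θ) (slice i r ψ)‖ ≤
      √c * (‖slice i r θ‖ * ‖slice i r ψ‖) := by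
    refine (abs_le_of_sq_le_sq' ?_ (by positivity)).2
    rw [mul_pow, Real.sq_sqrt hc0, mul_pow]
    exact hc r
  have h2 : ‖inner ℂ θ ψ‖ ≤ √c * ∑ r, ‖slice i r θ‖ * ‖slice i r ψ‖ := by
    rw [← sum_inner_slice i, Finset.mul_sum]
    exact (norm_sum_le _ _).trans (Finset.sum_le_sum fun r _ => h1 r)
  calc _ ≤ (√c * ∑ r, ‖slice i r θ‖ * ‖slice i r ψ‖) ^ 2 := by gcongr
    _ = c * (∑ r, ‖slice i r θ‖ * ‖slice i r ψ‖) ^ 2 := by rw [mul_pow, Real.sq_sqrt hc0]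
    _ ≤ c * ((∑ r, ‖slice i r θ‖ ^ 2) * ∑ r, ‖slice i r ψ‖ ^ 2) := by
      gcongr
      exact Finset.sum_mul_sq_le_sq_mul_sq _ _ _
    _ = _ := by rw [sum_norm_slice_sq, sum_norm_slice_sq]

end Slices

theorem isProduct_of_eq_mul {a b : Type*} [Fintype a] [Fintype b]
    {ψ : EuclideanSpace ℂ (a × b)} (f g : a × b → ℂ) (hψ : ∀ p, ψ p = f p * g p)
    (hf : ∀ x y y', f (x, y) = f (x, y')) (hg : ∀ x x' y, g (x, y) = g (x', y)) :
    IsProduct ψ := by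
  rcases isEmpty_or_nonempty (a × b) with h | ⟨⟨x₀, y₀⟩⟩
  · exact ⟨0, 0, by ext p; exact isEmptyElim p⟩
  · refine ⟨WithLp.toLp 2 fun x => f (x, y₀), WithLp.toLp 2 fun y => g (x₀, y), ?_⟩
    ext ⟨x, y⟩
    rw [hψ, hf x y y₀, hg x x₀ y]
    rfl

/-! ### Cuts of the chain of joined parties -/

section Joining

variable {n : ℕ} {α β : Fin n → Type*} [∀ i, Fintype (α i)] [∀ i, Fintype (β i)]

theorem slice_tprod (i : Fin n) (r : ∀ j : {j // j ≠ i}, α j × β j)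
    (ψ : ∀ i, EuclideanSpace ℂ (α i × β i)) :
    slice i r (tprod ψ) = (∏ j : {j // j ≠ i}, ψ j (r j)) • ψ i := by
  ext p
  simp only [slice_apply, tprod, PiLp.smul_apply, smul_eq_mul]
  rw [Fintype.prod_eq_mul_prod_subtype_ne _ i, mul_comm]
  congr 1
  · refine Finset.prod_congr rfl fun j _ => ?_
    simp [Equiv.piSplitAt, j.2]
  · simp [Equiv.piSplitAt]

theorem slice_mem {S : ∀ i, Submodule ℂ (EuclideanSpace ℂ (α i × β i))}
    {v : EuclideanSpace ℂ (∀ i, α i × β i)} (hv : v ∈ tensorSubspace S) (i : Fin n)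
    (r : ∀ j : {j // j ≠ i}, α j × β j) : slice i r v ∈ S i := by
  have h : tensorSubspace S ≤ (S i).comap (slice i r) := by
    refine Submodule.span_le.2 ?_
    rintro _ ⟨ψ, hψ, rfl⟩
    rw [SetLike.mem_coe, Submodule.mem_comap, slice_tprod]
    exact (S i).smul_mem _ (hψ i)
  exact h hv

theorem inner_tprod (φ ψ : ∀ i, EuclideanSpace ℂ (α i × β i)) :
    inner ℂ (tprod φ) (tprod ψ) = ∏ i, inner ℂ (φ i) (ψ i) := by
  simp only [PiLp.inner_apply, tprod, RCLike.inner_apply, map_prod, ← Finset.prod_mul_distrib]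
  rw [Finset.prod_univ_sum, Fintype.piFinset_univ]

theorem norm_tprod (φ : ∀ i, EuclideanSpace ℂ (α i × β i)) : ‖tprod φ‖ = ∏ i, ‖φ i‖ := by
  have h := inner_tprod φ φ
  simp only [inner_self_eq_norm_sq_to_K, Finset.prod_pow] at h
  have h2 : ‖tprod φ‖ ^ 2 = (∏ i, ‖φ i‖) ^ 2 := by exact_mod_cast h
  exact (sq_eq_sq₀ (norm_nonneg _) (Finset.prod_nonneg fun _ _ => norm_nonneg _)).1 h2

/-- Regarding a vector of the tensor product of `n` bipartite spaces as a bipartite vector with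
respect to a cut of the `n + 1` joined parties. -/
def joinAcross (A : Finset (Fin (n + 1))) :
    EuclideanSpace ℂ (∀ i, α i × β i) ≃ₗᵢ[ℂ]
      EuclideanSpace ℂ ((∀ k : {k // k ∈ A}, Party α β k) × (∀ k : {k // k ∉ A}, Party α β k)) :=
  (LinearIsometryEquiv.piLpCongrLeft 2 ℂ ℂ (joinEquiv α β)).trans (acrossCut A)

theorem joinAcross_apply (A : Finset (Fin (n + 1))) (θ : EuclideanSpace ℂ (∀ i, α i × β i))
    (z : ∀ i, α i × β i) :
    joinAcross A θ (fun k => joinEquiv α β z k, fun k => joinEquiv α β z k) = θ z := by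
  have h := (Equiv.piEquivPiSubtypeProd (fun k => k ∈ A) (Party α β)).symm_apply_apply
    (joinEquiv α β z)
  exact congrArg θ ((congrArg (joinEquiv α β).symm h).trans ((joinEquiv α β).symm_apply_apply z))

theorem mem_joinedSubspace {S : ∀ i, Submodule ℂ (EuclideanSpace ℂ (α i × β i))}
    {v : EuclideanSpace ℂ (∀ k, Party α β k)} (hv : v ∈ joinedSubspace S) :
    ∃ w ∈ tensorSubspace S, ‖w‖ = ‖v‖ ∧ ∀ A, acrossCut A v = joinAcross A w := by
  obtain ⟨w, hw, rfl⟩ := hv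
  exact ⟨w, hw, (LinearIsometryEquiv.norm_map _ w).symm, fun A => rfl⟩

theorem joinEquiv_congr_of_ne_succ {i : Fin n} {z z' : ∀ i, α i × β i}
    (h1 : (z i).1 = (z' i).1) (h2 : ∀ j, j ≠ i → z j = z' j) {k : Fin (n + 1)}
    (hk : k ≠ i.succ) : joinEquiv α β z k = joinEquiv α β z' k := by
  refine Prod.ext (funext ?_) (funext ?_)
  · rintro ⟨j, rfl⟩
    exact congrArg Prod.snd (h2 j fun h => hk (h ▸ rfl))
  · rintro ⟨j, rfl⟩
    rcases eq_or_ne j i with rfl | h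
    · exact h1
    · exact congrArg Prod.fst (h2 j h)

theorem joinEquiv_congr_of_ne_castSucc {i : Fin n} {z z' : ∀ i, α i × β i}
    (h1 : (z i).2 = (z' i).2) (h2 : ∀ j, j ≠ i → z j = z' j) {k : Fin (n + 1)}
    (hk : k ≠ i.castSucc) : joinEquiv α β z k = joinEquiv α β z' k := by
  refine Prod.ext (funext ?_) (funext ?_)
  · rintro ⟨j, rfl⟩
    rcases eq_or_ne j i with rfl | h
    · exact h1
    · exact congrArg Prod.snd (h2 j h)
  · rintro ⟨j, rfl⟩
    exact congrArg Prod.fst (h2 j fun h => hk (h ▸ rfl))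

/-- With the other pairs fixed, the first label of pair `i` affects only party `i.castSucc` and the
second only party `i.succ`. These lie on opposite sides of the cut, so `φ` and `χ` each depend on
one label. -/
theorem isProduct_slice {A : Finset (Fin (n + 1))} {i : Fin n}
    (hi : ¬(i.castSucc ∈ A ↔ i.succ ∈ A)) {θ : EuclideanSpace ℂ (∀ i, α i × β i)}
    (hθ : IsProduct (joinAcross A θ)) (r : ∀ j : {j // j ≠ i}, α j × β j) :
    IsProduct (slice i r θ) := by
  obtain ⟨φ, χ, h⟩ := hθ
  let σ := (Equiv.piSplitAt i fun j => α j × β j).symm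
  have hσ1 (p : α i × β i) : σ (p, r) i = p := by simp [σ, Equiv.piSplitAt]
  have hσ2 (p p' : α i × β i) (j) (hj : j ≠ i) : σ (p, r) j = σ (p', r) j := by
    simp [σ, Equiv.piSplitAt, hj]
  have hval (p : α i × β i) : slice i r θ p =
      φ (fun k => joinEquiv α β (σ (p, r)) k) * χ (fun k => joinEquiv α β (σ (p, r)) k) := by
    rw [slice_apply, ← joinAcross_apply A, h]
    rfl
  have hs (x : α i) (y y' : β i) {k : Fin (n + 1)} (hk : k ≠ i.succ) :
      joinEquiv α β (σ ((x, y), r)) k = joinEquiv α β (σ ((x, y'), r)) k :=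
    joinEquiv_congr_of_ne_succ (i := i) (by rw [hσ1, hσ1]) (hσ2 _ _) hk
  have hc (x x' : α i) (y : β i) {k : Fin (n + 1)} (hk : k ≠ i.castSucc) :
      joinEquiv α β (σ ((x, y), r)) k = joinEquiv α β (σ ((x', y), r)) k :=
    joinEquiv_congr_of_ne_castSucc (i := i) (by rw [hσ1, hσ1]) (hσ2 _ _) hk
  by_cases hA : i.succ ∈ A
  · have hA' : i.castSucc ∉ A := fun h => hi (by simp [h, hA])
    refine isProduct_of_eq_mul _ _ (fun p => (hval p).trans (mul_comm _ _)) ?_ ?_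
    · exact fun x y y' => congrArg χ (funext fun k => hs x y y' fun h => k.2 (h ▸ hA))
    · exact fun x x' y => congrArg φ (funext fun k => hc x x' y fun h => hA' (h ▸ k.2))
  · have hA' : i.castSucc ∈ A := by
      by_contra h
      exact hi (by simp [h, hA])
    refine isProduct_of_eq_mul _ _ hval ?_ ?_
    · exact fun x y y' => congrArg φ (funext fun k => hs x y y' fun h => hA (h ▸ k.2))
    · exact fun x x' y => congrArg χ (funext fun k => hc x x' y fun h => k.2 (h ▸ hA'))

/-- Otherwise membership in `A` would propagate along the chain from party `0`, leaving one side
empty. -/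
theorem exists_separated_pair (A : Cut (Fin (n + 1))) :
    ∃ i : Fin n, ¬(i.castSucc ∈ A.1 ↔ i.succ ∈ A.1) := by
  by_contra! h
  have h0 (k : Fin (n + 1)) : k ∈ A.1 ↔ 0 ∈ A.1 := by
    induction k using Fin.induction with
    | zero => rfl
    | succ i ih => rw [← h i, ih]
  obtain ⟨⟨k, hk⟩, ⟨l, hl⟩⟩ := A.2
  exact (Finset.mem_compl.1 hl) ((h0 l).2 ((h0 k).1 hk))

/-- The cut of the joined parties into those up to the `i`-th one and those after it. -/
def initialCut (i : Fin n) : Cut (Fin (n + 1)) :=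
  ⟨Finset.Iic i.castSucc, ⟨i.castSucc, by simp⟩, ⟨i.succ, by simp⟩⟩

theorem isProduct_joinAcross_tprod (i : Fin n) {ψ : ∀ j, EuclideanSpace ℂ (α j × β j)}
    (hi : IsProduct (ψ i)) : IsProduct (joinAcross (initialCut i).1 (tprod ψ)) := by
  obtain ⟨e, f, hef⟩ := hi
  have hle {j : Fin n} (h : j < i) : j.castSucc ∈ (initialCut i).1 := by
    simpa [initialCut] using h.le
  have hle' {j : Fin n} (h : j < i) : j.succ ∈ (initialCut i).1 := by
    simpa [initialCut, Fin.succ_le_castSucc_iff] using h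
  have hgt {j : Fin n} (h : i < j) : j.castSucc ∉ (initialCut i).1 := by
    simpa [initialCut] using h
  have hgt' {j : Fin n} (h : i ≤ j) : j.succ ∉ (initialCut i).1 := by
    simpa [initialCut, Fin.succ_le_castSucc_iff] using h
  have hi' : i.castSucc ∈ (initialCut i).1 := by simp [initialCut]
  -- Pairs before `i` lie wholly on the left, those after `i` wholly on the right. The filler `1`
  -- lets both products run over all `j` and be multiplied termwise.
  refine ⟨WithLp.toLp 2 fun u => ∏ j, if h : j < i then
      ψ j ((u ⟨j.castSucc, hle h⟩).2 ⟨j, rfl⟩, (u ⟨j.succ, hle' h⟩).1 ⟨j, rfl⟩)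
      else if j = i then e ((u ⟨i.castSucc, hi'⟩).2 ⟨i, rfl⟩) else 1,
    WithLp.toLp 2 fun u => ∏ j, if h : i < j then
      ψ j ((u ⟨j.castSucc, hgt h⟩).2 ⟨j, rfl⟩, (u ⟨j.succ, hgt' h.le⟩).1 ⟨j, rfl⟩)
      else if j = i then f ((u ⟨i.succ, hgt' le_rfl⟩).1 ⟨i, rfl⟩) else 1, ?_⟩
  ext x
  obtain ⟨z, rfl⟩ : ∃ z, x = ((fun k => joinEquiv α β z k, fun k => joinEquiv α β z k) :
      (∀ k : {k // k ∈ (initialCut i).1}, Party α β k) ×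
        (∀ k : {k // k ∉ (initialCut i).1}, Party α β k)) := by
    refine ⟨(joinEquiv α β).symm ((Equiv.piEquivPiSubtypeProd _ _).symm x), ?_⟩
    rw [Equiv.apply_symm_apply]
    exact ((Equiv.piEquivPiSubtypeProd _ _).apply_symm_apply x).symm
  rw [joinAcross_apply]
  simp only [tprod, tmul_apply, ← Finset.prod_mul_distrib]
  refine Finset.prod_congr rfl fun j _ => ?_
  rcases lt_trichotomy j i with h | rfl | h
  · simp [h, h.not_gt, h.ne, joinEquiv]
  · simp [hef, joinEquiv]
  · simp [h, h.not_gt, h.ne', joinEquiv]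

end Joining

/-! ### The two bounds for the joined subspace -/

section Joining

variable {n : ℕ} {α β : Fin n → Type*} [∀ i, Fintype (α i)] [∀ i, Fintype (β i)]
  {S : ∀ i, Submodule ℂ (EuclideanSpace ℂ (α i × β i))}

theorem isGenuinelyEntangled_joinedSubspace (hS : ∀ i, IsCompletelyEntangled (S i)) :
    IsGenuinelyEntangled (joinedSubspace S) := by
  rintro v ⟨hv, hv1⟩ ⟨A, hA⟩
  obtain ⟨w, hw, hnorm, hcut⟩ := mem_joinedSubspace hv
  rw [hcut] at hA
  obtain ⟨i, hi⟩ := exists_separated_pair A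
  have hw0 : w ≠ 0 := by
    rintro rfl
    simp [hv1] at hnorm
  obtain ⟨r, hr⟩ := exists_slice_ne_zero i hw0
  obtain ⟨φ, χ, h⟩ := isProduct_slice hi hA r
  exact hS i _ (smul_mem_states (slice_mem hw i r) hr)
    ⟨_, χ, by rw [h, ← tmul_smul_left]⟩

theorem subspaceMeasure_le_geometricMeasure_acrossCut (hne : ∀ i, S i ≠ ⊥)
    {v : EuclideanSpace ℂ (∀ k, Party α β k)} (hv : v ∈ states (joinedSubspace S))
    (A : Cut (Fin (n + 1))) :
    ∃ i, subspaceMeasure geometricMeasure (S i) ≤ geometricMeasure (acrossCut A.1 v) := by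
  obtain ⟨w, hw, hnorm, hcut⟩ := mem_joinedSubspace hv.1
  obtain ⟨i, hi⟩ := exists_separated_pair A
  refine ⟨i, ?_⟩
  obtain ⟨ψ₀, -, hψ₀⟩ := (isLeast_subspaceMeasure continuous_geometricMeasure (hne i)).1
  have hc0 : 0 ≤ 1 - subspaceMeasure geometricMeasure (S i) := by
    rw [← hψ₀, geometricMeasure, sub_sub_cancel]
    exact sSup_schmidtSq_nonneg ψ₀
  rw [hcut, geometricMeasure, le_sub_comm]
  refine sSup_schmidtSq_le hc0 fun φ χ => ?_
  -- The test vector is pulled back to the tensor product of pairs, where it can be sliced.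
  obtain ⟨θ, hθ⟩ := (joinAcross A.1).surjective (tmul φ χ)
  have h := norm_inner_sq_le_of_slice i (θ := θ) (ψ := w) hc0 fun r => by
    obtain ⟨φ', χ', h'⟩ := isProduct_slice hi ⟨φ, χ, hθ⟩ r
    rw [h']
    exact norm_inner_tmul_sq_le_of_mem (hne i) (slice_mem hw i r) φ' χ'
  rw [← hθ, LinearIsometryEquiv.inner_map_map, ← mul_pow, ← norm_tmul, ← hθ,
    LinearIsometryEquiv.norm_map]
  rwa [hnorm, hv.2, one_pow, mul_one] at h

/-- Replacing the `i`-th factor by `e ⊗ f` gives a product test vector across the cut; the other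
factors contribute `1`, leaving the overlap `⟨e ⊗ f, ψ i⟩`. -/
theorem geometricMeasure_joinAcross_tprod_le {ψ : ∀ j, EuclideanSpace ℂ (α j × β j)}
    (hψ : ∀ j, ‖ψ j‖ = 1) (i : Fin n) :
    geometricMeasure (joinAcross (initialCut i).1 (tprod ψ)) ≤ geometricMeasure (ψ i) := by
  refine sub_le_sub_left (sSup_schmidtSq_le (sSup_schmidtSq_nonneg _) fun e f => ?_) _
  have hp : IsProduct (Function.update ψ i (tmul e f) i) :=
    ⟨e, f, Function.update_self i _ ψ⟩
  obtain ⟨φ, χ, h⟩ := isProduct_joinAcross_tprod i hp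
  have h1 := norm_inner_tmul_sq_le (joinAcross (initialCut i).1 (tprod ψ)) φ χ
  rw [← mul_pow, ← norm_tmul, ← h, LinearIsometryEquiv.inner_map_map,
    LinearIsometryEquiv.norm_map, inner_tprod, norm_tprod, norm_prod,
    Fintype.prod_eq_mul_prod_subtype_ne _ i,
    Fintype.prod_eq_mul_prod_subtype_ne (fun j => ‖Function.update ψ i (tmul e f) j‖) i,
    Finset.prod_eq_one, Finset.prod_eq_one, mul_one, mul_one, Function.update_self,
    norm_tmul, mul_pow] at h1
  · exact h1
  · rintro j -
    rw [Function.update_of_ne j.2, hψ]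
  · rintro j -
    rw [Function.update_of_ne j.2, inner_self_eq_norm_sq_to_K, hψ]
    simp

end Joining

end EntangledSubspace

end

open EntangledSubspace in
theorem corollary1 {n : ℕ} (hn : 2 ≤ n) {α β : Fin n → Type*}
    [∀ i, Fintype (α i)] [∀ i, Fintype (β i)]
    (S : ∀ i, Submodule ℂ (EuclideanSpace ℂ (α i × β i)))
    (hne : ∀ i, S i ≠ ⊥) (hS : ∀ i, IsCompletelyEntangled (S i)) :
    IsGenuinelyEntangled (joinedSubspace S) ∧
    (∀ i, IsLeast (geometricMeasure '' states (S i))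
      (subspaceMeasure geometricMeasure (S i))) ∧
    IsLeast (geometricMeasureGME '' states (joinedSubspace S))
      (subspaceMeasure geometricMeasureGME (joinedSubspace S)) ∧
    subspaceMeasure geometricMeasureGME (joinedSubspace S) =
      ⨅ i, subspaceMeasure geometricMeasure (S i) := by
  have hleast i := isLeast_subspaceMeasure continuous_geometricMeasure (hne i)
  have : Nonempty (Fin n) := ⟨⟨0, by omega⟩⟩
  have : Nonempty (Cut (Fin (n + 1))) := this.map initialCut
  have hlb : ∀ v ∈ states (joinedSubspace S),
      ⨅ i, subspaceMeasure geometricMeasure (S i) ≤ geometricMeasureGME v := fun v hv =>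
    le_ciInf fun A => by
      obtain ⟨i, hi⟩ := subspaceMeasure_le_geometricMeasure_acrossCut hne hv A
      exact (ciInf_le (Set.finite_range _).bddBelow i).trans hi
  -- An explicit minimiser gives attainment and the value together.
  have hmin : IsLeast (geometricMeasureGME '' states (joinedSubspace S))
      (⨅ i, subspaceMeasure geometricMeasure (S i)) := by
    choose ψ hψ hψG using fun i => (hleast i).1
    obtain ⟨i, hi⟩ := exists_eq_ciInf_of_finite
      (f := fun i => subspaceMeasure geometricMeasure (S i))
    have hv : LinearIsometryEquiv.piLpCongrLeft 2 ℂ ℂ (joinEquiv α β) (tprod ψ) ∈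
        states (joinedSubspace S) := by
      refine ⟨Submodule.mem_map_of_mem (Submodule.subset_span ⟨ψ, fun j => (hψ j).1, rfl⟩), ?_⟩
      rw [LinearIsometryEquiv.norm_map, norm_tprod]
      exact Finset.prod_eq_one fun j _ => (hψ j).2
    refine ⟨⟨_, hv, le_antisymm ?_ (hlb _ hv)⟩, ?_⟩
    · rw [← hi, ← hψG]
      exact (ciInf_le (Set.finite_range _).bddBelow (initialCut i)).trans
        (geometricMeasure_joinAcross_tprod_le (fun j => (hψ j).2) i)
    · rintro _ ⟨v, hv, rfl⟩
      exact hlb v hv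
  have heq : subspaceMeasure geometricMeasureGME (joinedSubspace S) =
      ⨅ i, subspaceMeasure geometricMeasure (S i) := hmin.csInf_eq
  exact ⟨isGenuinelyEntangled_joinedSubspace hS, hleast, heq ▸ hmin, heq⟩
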